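/- Let $K$ be a field of characteristic zero, $d\ge 0$ an integer, $\underline{x}=(x_1,\dots,x_d)$, and let $K[[\underline{x}^{1/\mathbf N}]]=\bigcup_{k\ge 1}K[[x_1^{1/k},\dots,x_d^{1/k}]]$ be the ring of fractional power series. A Weierstrass polynomial is a monic polynomial in $K[[\underline{x}]][y]$ all of whose coefficients other than the leading one are non-units of $K[[\underline{x}]]$ (the constant polynomial $1$ is allowed). Let $f,g\in K[[\underline{x}]][y]$ be Weierstrass polynomials and write $$\mathrm{Res}_y\bigl(g(y),\,f(y)-T\bigr)=c_0T^m+c_1T^{m-1}+\cdots+c_m\in K[[\underline{x}]][T],\qquad m=\deg g,\quad c_0=\pm 1 .$$ Assume that there is $\mathbf q\in\mathbf Q^d$ such that $$c_i\,K[[\underline{x}^{1/\mathbf N}]]\subseteq \underline{x}^{i\mathbf q}\,K[[\underline{x}^{1/\mathbf N}]]\qquad\text{for all }1\le i\le m,$$ with equality for some $i=i_0$ with $1\le i_0<m$, and with strict inclusion for $i=m$. Then $g$ is not irreducible in the ring $K[[\underline{x}]][y]$. -/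

import Mathlib

open Polynomial

noncomputable section

namespace WeierstrassNewton

/-- A Weierstrass polynomial over `K[[x_1, …, x_d]]`: a monic polynomial all of whose
coefficients other than the leading one are non-units. (The constant polynomial `1` is allowed.) -/
def IsWeierstrass {d : ℕ} {K : Type*} [Field K] (g : (MvPowerSeries (Fin d) K)[X]) : Prop :=
  g.Monic ∧ ∀ j < g.natDegree, ¬ IsUnit (g.coeff j)

/-- The ring `K[[x_1^{1/ℕ}, …, x_d^{1/ℕ}]]` of fractional power series, i.e. the union over `k ≥ 1`
of the rings `K[[x_1^{1/k}, …, x_d^{1/k}]]`: formal series whose exponents all lie in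
`((1/k) ℕ)^d` for a common `k ≥ 1`. It is realised inside the ring of Hahn series with exponents in
`ℚ^d`, in which `x^q` makes sense for every `q ∈ ℚ^d`. -/
def fracPowerSeries (d : ℕ) (K : Type*) [Field K] : Subring (HahnSeries (Fin d → ℚ) K) where
  carrier := {α | ∃ k : ℕ, 0 < k ∧ ∀ e ∈ α.support, ∀ j, ∃ n : ℕ, e j = (n : ℚ) / k}
  zero_mem' := ⟨1, one_pos, by simp⟩
  one_mem' := ⟨1, one_pos, by
    intro e he j
    rw [HahnSeries.support_one, Set.mem_singleton_iff] at he
    exact ⟨0, by simp [he]⟩⟩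
  neg_mem' := by
    rintro α ⟨k, hk, h⟩
    exact ⟨k, hk, by simpa only [HahnSeries.support_neg] using h⟩
  add_mem' := by
    rintro α β ⟨k, hk, h⟩ ⟨l, hl, h'⟩
    have hk' : (k : ℚ) ≠ 0 := by positivity
    have hl' : (l : ℚ) ≠ 0 := by positivity
    refine ⟨k * l, Nat.mul_pos hk hl, fun e he j => ?_⟩
    rcases HahnSeries.support_add_subset α β he with he | he
    · obtain ⟨n, hn⟩ := h e he j
      exact ⟨n * l, by rw [hn]; push_cast; field_simp⟩
    · obtain ⟨n, hn⟩ := h' e he j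
      exact ⟨n * k, by rw [hn]; push_cast; field_simp⟩
  mul_mem' := by
    rintro α β ⟨k, hk, h⟩ ⟨l, hl, h'⟩
    have hk' : (k : ℚ) ≠ 0 := by positivity
    have hl' : (l : ℚ) ≠ 0 := by positivity
    refine ⟨k * l, Nat.mul_pos hk hl, fun e he j => ?_⟩
    obtain ⟨a, ha, b, hb, rfl⟩ := Set.mem_add.mp (HahnSeries.support_mul_subset he)
    obtain ⟨n, hn⟩ := h a ha j
    obtain ⟨p, hp⟩ := h' b hb j
    exact ⟨n * l + p * k, by rw [Pi.add_apply, hn, hp]; push_cast; field_simp⟩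

/-- The inclusion of exponents `ℕ^d ⊆ ℚ^d`. -/
def exponentHom (d : ℕ) : (Fin d →₀ ℕ) →+ (Fin d → ℚ) where
  toFun n j := n j
  map_zero' := by ext; simp
  map_add' _ _ := by ext; simp

theorem exponentHom_injective (d : ℕ) : Function.Injective (exponentHom d) := by
  intro a b h
  ext j
  have hj : ((a j : ℕ) : ℚ) = b j := congrFun h j
  exact_mod_cast hj

theorem exponentHom_le_iff (d : ℕ) (a b : Fin d →₀ ℕ) :
    exponentHom d a ≤ exponentHom d b ↔ a ≤ b := by
  simp [exponentHom, Pi.le_def, Finsupp.le_def]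

/-- The inclusion of `K[[x_1, …, x_d]]` into the ring of Hahn series with exponents in `ℚ^d`. -/
def ofPowerSeries (d : ℕ) (K : Type*) [Field K] :
    MvPowerSeries (Fin d) K →+* HahnSeries (Fin d → ℚ) K :=
  (HahnSeries.embDomainRingHom (exponentHom d) (exponentHom_injective d)
    (exponentHom_le_iff d)).comp (RingEquiv.toRingHom HahnSeries.toMvPowerSeries.symm)

/-- `K[[x]] ⊆ K[[x^{1/ℕ}]]`. -/
theorem ofPowerSeries_mem {d : ℕ} {K : Type*} [Field K] (c : MvPowerSeries (Fin d) K) :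
    ofPowerSeries d K c ∈ fracPowerSeries d K := by
  refine ⟨1, one_pos, fun e he j => ?_⟩
  obtain ⟨n, -, rfl⟩ := HahnSeries.support_embDomain_subset he
  exact ⟨n j, by simp [exponentHom]⟩

/-- The monomial `x^q` with exponent `q ∈ ℚ^d`. -/
def fracMonomial {d : ℕ} (K : Type*) [Field K] (q : Fin d → ℚ) : HahnSeries (Fin d → ℚ) K :=
  HahnSeries.single q 1

/-- `α K[[x^{1/ℕ}]] = {α w : w ∈ K[[x^{1/ℕ}]]}`. -/
def fracMultiples {d : ℕ} {K : Type*} [Field K] (α : HahnSeries (Fin d → ℚ) K) :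
    Set (HahnSeries (Fin d → ℚ) K) :=
  {β | ∃ w ∈ fracPowerSeries d K, β = α * w}

/-- The coefficient-divisibility condition on `P = c_0 T^m + c_1 T^{m-1} + ⋯ + c_m`, `m = deg P`:
there is `q ∈ ℚ^d` such that `c_i K[[x^{1/ℕ}]] ⊆ x^{iq} K[[x^{1/ℕ}]]` for `1 ≤ i ≤ m`, with
equality for some `1 ≤ i₀ < m` and with strict inclusion for `i = m`. -/
def HasSlopeCondition {d : ℕ} {K : Type*} [Field K] (P : (MvPowerSeries (Fin d) K)[X]) : Prop :=
  ∃ q : Fin d → ℚ,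
    (∀ i : ℕ, 1 ≤ i → i ≤ P.natDegree →
      fracMultiples (ofPowerSeries d K (P.coeff (P.natDegree - i))) ⊆
        fracMultiples (fracMonomial K (i • q))) ∧
    (∃ i₀ : ℕ, 1 ≤ i₀ ∧ i₀ < P.natDegree ∧
      fracMultiples (ofPowerSeries d K (P.coeff (P.natDegree - i₀))) =
        fracMultiples (fracMonomial K (i₀ • q))) ∧
    fracMultiples (ofPowerSeries d K (P.coeff 0)) ⊂
      fracMultiples (fracMonomial K (P.natDegree • q))

/-- `Res_y(g(y), f(y) - T)`, a polynomial in `T` over `A`. Inside the resultant the outer variable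
of `A[T][y]` is `y`, and `T` is the inner variable, `C X`. -/
def resultantSubT {A : Type*} [CommRing A] (g f : A[X]) : A[X] :=
  resultant (g.map (C : A →+* A[X])) (f.map (C : A →+* A[X]) - C X)

end WeierstrassNewton

end

/-! Over an algebraic closure, `P = Res_y(g, f - T)` is the product of the `f(β) - T` over the roots
`β` of `g`. After `x ↦ x^k` for a common denominator `k`, the slope condition lets `T = x^r S` turn
`±P` into `x^(m r) h(S)` with `h` monic over `K[[x]]`. Modulo the maximal ideal, `h` has zero
constant term but another nonzero coefficient below the leading one, so it equals `S^s p` with `p(0)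
≠ 0` and `0 < s < m`. Hensel's lemma splits `h` into two coprime factors.

A priori these factors only give a factorization over `K[[x^{1/k}]]`. That `h` comes from a
polynomial in `x^k` is a homogeneity condition for a `(ℤ/k)^d`-grading, and the Hensel construction
respects it (`exists_homogeneous_factorization`). Hence `±P = G₁ G₂` already over `K[[x]]`
(`exists_coprime_factorization`).

Suppose `g` is irreducible. Since `K[[x]]` is normal, `g` is the minimal polynomial of each of its
roots. Each `Gᵢ` vanishes at some `f(β)`, so `g` divides both `Gᵢ ∘ f`
(`dvd_comp_of_dvd_resultantSubT`). These are coprime over a field, so the monic `g` would be `1`. -/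

noncomputable section

/-! ### Normality of power series rings. -/

namespace PowerSeries

variable {R : Type*} [CommRing R] [IsDomain R] (F : Type*) [Field F] [Algebra R F]

/-- If `c` is a common denominator of the powers of `X ^ i * v`, comparing coefficients of degree
`ord c + i n` shows that the lowest coefficient of `c` is a common denominator of the powers of
`v(0)`. -/
theorem leading_coeff_isAlmostIntegral {i : ℕ} {v : F⟦X⟧}
    (h : IsAlmostIntegral R⟦X⟧ (X ^ i * v)) : IsAlmostIntegral R (constantCoeff v) := by
  obtain ⟨c, hc, h⟩ := h
  have hc0 : c ≠ 0 := nonZeroDivisors.ne_zero hc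
  refine ⟨coeff c.order.toNat c, mem_nonZeroDivisors_of_ne_zero (coeff_order hc0), fun n => ?_⟩
  obtain ⟨y, hy⟩ := h n
  refine ⟨coeff (c.order.toNat + i * n) y, ?_⟩
  have h1 := congrArg (coeff (c.order.toNat + i * n)) hy
  obtain ⟨u, hu⟩ : X ^ c.order.toNat ∣ c := X_pow_order_dvd
  have hu0 : constantCoeff u = coeff c.order.toNat c := by
    have h3 := coeff_X_pow_mul u c.order.toNat 0
    rw [zero_add, ← hu] at h3
    rw [h3, coeff_zero_eq_constantCoeff_apply]
  rw [algebraMap_apply'', coeff_map] at h1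
  rw [h1, ← hu0, Algebra.smul_def, algebraMap_apply'']
  have : map (algebraMap R F) c * (X ^ i * v) ^ n
      = X ^ (c.order.toNat + i * n) * (map (algebraMap R F) u * v ^ n) := by
    conv_lhs => rw [hu]
    simp only [map_mul, map_pow, map_X]
    ring
  rw [this, Algebra.smul_def]
  have h2 := coeff_X_pow_mul (map (algebraMap R F) u * v ^ n) (c.order.toNat + i * n) 0
  rw [zero_add] at h2
  rw [h2, coeff_zero_eq_constantCoeff_apply, map_mul, map_pow,
    ← coeff_zero_eq_constantCoeff_apply (map _ u), coeff_map, coeff_zero_eq_constantCoeff_apply]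

variable [IsNoetherianRing R] [IsIntegrallyClosed R]

/-- Subtracting the lower terms, already known to lie in `R`, leaves an almost integral series `X ^
i * v`. Then `v(0)` is almost integral over the noetherian normal ring `R`, hence in `R`. -/
theorem coeff_mem_range_of_isAlmostIntegral [IsFractionRing R F] {w : F⟦X⟧} (h : IsAlmostIntegral R⟦X⟧ w) (i : ℕ) :
    coeff i w ∈ (algebraMap R F).range := by
  induction i using Nat.strong_induction_on with
  | _ i ih =>
  choose! b hb using fun j (hj : j < i) => RingHom.mem_range.mp (ih j hj)
  set t : R⟦X⟧ := PowerSeries.mk fun j => if j < i then b j else 0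
  have hw : IsAlmostIntegral R⟦X⟧ (w - algebraMap R⟦X⟧ F⟦X⟧ t) :=
    (completeIntegralClosure R⟦X⟧ F⟦X⟧).sub_mem h (algebraMap_mem _ t)
  obtain ⟨v, hv⟩ : X ^ i ∣ w - algebraMap R⟦X⟧ F⟦X⟧ t := by
    rw [X_pow_dvd_iff]
    intro j hj
    simp [algebraMap_apply'', t, hj, hb j hj]
  rw [hv] at hw
  have h1 := (leading_coeff_isAlmostIntegral F hw).isIntegral
  have h2 : coeff i w = constantCoeff v := by
    have := congrArg (coeff i) hv
    have h3 := coeff_X_pow_mul v i 0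
    rw [zero_add] at h3
    rw [h3] at this
    simpa [algebraMap_apply'', t] using this
  rw [h2]
  exact IsIntegrallyClosed.isIntegral_iff.mp h1

variable (R) in
-- An integral fraction `a / b` lies in the normal ring `F⟦X⟧`, so `a = b w` there. Almost
-- integrality passes from `a / b` to `w`, which places the coefficients of `w` in `R`.
protected theorem isIntegrallyClosed : IsIntegrallyClosed R⟦X⟧ := by
  let F := FractionRing R
  let φ : R⟦X⟧ →+* F⟦X⟧ := map (algebraMap R F)
  have hφ : Function.Injective φ := map_injective _ (IsFractionRing.injective R F)
  rw [isIntegrallyClosed_iff (FractionRing R⟦X⟧)]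
  intro x hx
  obtain ⟨a, b, hb, rfl⟩ := IsFractionRing.div_surjective (A := R⟦X⟧) x
  have hb0 : b ≠ 0 := nonZeroDivisors.ne_zero hb
  have hb1 : algebraMap R⟦X⟧ (FractionRing R⟦X⟧) b ≠ 0 := by simpa using hb0
  have key : ∀ {y : R⟦X⟧} {c : R⟦X⟧} {n : ℕ}, algebraMap R⟦X⟧ (FractionRing R⟦X⟧) y =
      c • (algebraMap R⟦X⟧ (FractionRing R⟦X⟧) a / algebraMap R⟦X⟧ (FractionRing R⟦X⟧) b) ^ n →
      b ^ n * y = c * a ^ n := by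
    intro y c n h
    apply IsFractionRing.injective R⟦X⟧ (FractionRing R⟦X⟧)
    rw [map_mul, h, Algebra.smul_def, map_mul, div_pow, map_pow, map_pow]
    field_simp
  obtain ⟨c, hc, hca⟩ := hx.isAlmostIntegral
  have hc0 : c ≠ 0 := nonZeroDivisors.ne_zero hc
  have hdvd : φ b ∣ φ a := by
    let ψ : FractionRing R⟦X⟧ →+* FractionRing F⟦X⟧ := IsFractionRing.map (A := R⟦X⟧) hφ
    have hψ : ∀ z, ψ (algebraMap _ _ z) = algebraMap _ _ (φ z) :=
      fun z => IsLocalization.map_eq _ z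
    have h1 := hx.map_of_comp_eq φ ψ (by ext z; exact (hψ z).symm)
    obtain ⟨w, hw⟩ := IsIntegrallyClosed.isIntegral_iff.mp h1
    refine ⟨w, IsFractionRing.injective F⟦X⟧ (FractionRing F⟦X⟧) ?_⟩
    have hψb : ψ (algebraMap _ _ b) ≠ 0 := (map_ne_zero ψ).mpr hb1
    rw [map_mul, hw, map_div₀, ← hψ, ← hψ]
    field_simp
  obtain ⟨w, hw⟩ := hdvd
  have hφb : φ b ≠ 0 := (map_ne_zero_iff φ hφ).mpr hb0
  have hwint : IsAlmostIntegral R⟦X⟧ w := by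
    refine ⟨c, hc, fun n => ?_⟩
    obtain ⟨y, hy⟩ := hca n
    refine ⟨y, ?_⟩
    have h1 := congrArg φ (key hy)
    rw [map_mul, map_mul, map_pow, map_pow, hw, mul_pow] at h1
    apply mul_left_cancel₀ (pow_ne_zero n hφb)
    rw [Algebra.smul_def, algebraMap_apply'', algebraMap_apply'']
    change φ b ^ n * φ y = _ * (φ c * _)
    rw [h1]; ring
  choose z hz using fun i => RingHom.mem_range.mp (coeff_mem_range_of_isAlmostIntegral F hwint i)
  have hwz : w = φ (PowerSeries.mk z) := by
    ext i; simp [φ, hz]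
  refine ⟨PowerSeries.mk z, ?_⟩
  rw [eq_div_iff hb1, ← map_mul]
  congr 1
  apply hφ
  rw [map_mul, ← hwz, hw, mul_comm]

end PowerSeries

namespace MvPowerSeries

instance isIntegrallyClosed_fin (K : Type*) [Field K] (d : ℕ) :
    IsIntegrallyClosed (MvPowerSeries (Fin d) K) := by
  induction d with
  | zero => exact IsIntegrallyClosed.of_equiv (isEmptyEquiv (R := K) (Fin 0)).toRingEquiv.symm
  | succ n ih =>
    have : IsDomain (MvPowerSeries (Fin n) K) := NoZeroDivisors.to_isDomain _
    have := PowerSeries.isIntegrallyClosed (MvPowerSeries (Fin n) K)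
    exact IsIntegrallyClosed.of_equiv (finSuccEquiv K n).toRingEquiv.symm

end MvPowerSeries

/-! ### A graded Hensel lemma over `K[[x]]`. -/

namespace WeierstrassNewton

variable {σ K : Type*} [Field K]

/-- The polynomials `u` such that every monomial `x^e T^j` with `j` in the support of `u` has degree
`-a r` modulo `k`, when `x_i` has degree the `i`-th unit vector and `T` has degree `-r`. -/
def homogeneousAt (K : Type*) [Field K] (k : ℕ) (r e : σ →₀ ℕ) (a : ℕ) : AddSubgroup K[X] where
  carrier := {u | ∀ j, u.coeff j ≠ 0 → ∀ i, (e i : ZMod k) + ((a : ZMod k) - j) * r i = 0}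
  zero_mem' := by simp
  add_mem' := by
    intro u v hu hv j hj
    by_cases h : u.coeff j = 0
    · exact hv j fun h' => hj (by rw [coeff_add, h, h', add_zero])
    · exact hu j h
  neg_mem' := by
    intro u hu j hj
    exact hu j (by simpa using hj)

theorem mem_homogeneousAt {k : ℕ} {r e : σ →₀ ℕ} {a : ℕ} {u : K[X]} :
    u ∈ homogeneousAt K k r e a ↔
      ∀ j, u.coeff j ≠ 0 → ∀ i, (e i : ZMod k) + ((a : ZMod k) - j) * r i = 0 := Iff.rfl

theorem mul_mem_homogeneousAt {k : ℕ} {r e e' : σ →₀ ℕ} {a b : ℕ} {u v : K[X]}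
    (hu : u ∈ homogeneousAt K k r e a) (hv : v ∈ homogeneousAt K k r e' b) :
    u * v ∈ homogeneousAt K k r (e + e') (a + b) := by
  intro j hj i
  rw [coeff_mul] at hj
  obtain ⟨⟨x, y⟩, hx, hxy⟩ := Finset.exists_ne_zero_of_sum_ne_zero hj
  have h1 := hu x (left_ne_zero_of_mul hxy) i
  have h2 := hv y (right_ne_zero_of_mul hxy) i
  rw [Finset.HasAntidiagonal.mem_antidiagonal] at hx
  dsimp only at hx
  rw [← hx, Finsupp.add_apply]
  push_cast
  linear_combination h1 + h2

/-- Since `p(0)` is invertible, the equation modulo `X ^ s` determines the coefficients of `a` one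
after another from those of `w` and `p`, and each step respects the grading. Then `X ^ s * b` is a
difference of homogeneous terms. -/
theorem homogeneous_of_mul_add_X_pow_mul {k : ℕ} {r e : σ →₀ ℕ} {s n : ℕ} {p w a b : K[X]}
    (hp0 : p.coeff 0 ≠ 0) (h : a * p + X ^ s * b = w) (ha : a.degree < s)
    (hp : p ∈ homogeneousAt K k r 0 n) (hw : w ∈ homogeneousAt K k r e (s + n)) :
    a ∈ homogeneousAt K k r e s ∧ b ∈ homogeneousAt K k r e n := by
  -- As `p(0) ≠ 0`, homogeneity forces `n r = 0` modulo `k`, so dividing by `p(0)` does not change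
  -- degrees.
  have hpn := fun i => hp 0 hp0 i
  have haH : a ∈ homogeneousAt K k r e s := by
    intro j
    induction j using Nat.strong_induction_on with
    | _ j ih =>
    intro hj i
    have hjs : j < s := by
      by_contra! hjs
      exact hj (coeff_eq_zero_of_degree_lt (ha.trans_le (by exact_mod_cast hjs)))
    have h1 := congrArg (fun z => coeff z j) h
    simp only [coeff_add] at h1
    rw [coeff_X_pow_mul', if_neg (not_le.mpr hjs), add_zero, coeff_mul] at h1
    have hmem : (j, 0) ∈ Finset.HasAntidiagonal.antidiagonal j := by simp
    rw [← Finset.add_sum_erase _ _ hmem] at h1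
    have hn := hpn i
    simp only [Finsupp.coe_zero, Pi.zero_apply, Nat.cast_zero, sub_zero, zero_add] at hn
    by_cases hwj : w.coeff j = 0
    · have h2 : ∑ x ∈ (Finset.HasAntidiagonal.antidiagonal j).erase (j, 0), a.coeff x.1 * p.coeff x.2 ≠ 0 := by
        intro h0
        rw [h0, add_zero, hwj] at h1
        exact mul_ne_zero hj hp0 h1
      obtain ⟨⟨x, y⟩, hx, hxy⟩ := Finset.exists_ne_zero_of_sum_ne_zero h2
      rw [Finset.mem_erase, Finset.HasAntidiagonal.mem_antidiagonal] at hx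
      obtain ⟨hne, hx⟩ := hx
      dsimp only at hx
      have hy0 : y ≠ 0 := by
        rintro rfl
        exact hne (by simpa using hx)
      have h3 := ih x (by lia) (left_ne_zero_of_mul hxy) i
      have h4 := hp y (right_ne_zero_of_mul hxy) i
      simp only [Finsupp.coe_zero, Pi.zero_apply, Nat.cast_zero, zero_add] at h4
      rw [← hx]
      push_cast
      linear_combination h3 + h4 - hn
    · have h3 := hw j hwj i
      push_cast at h3
      linear_combination h3 - hn
  refine ⟨haH, ?_⟩
  have hb : X ^ s * b ∈ homogeneousAt K k r e (s + n) := by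
    rw [← eq_sub_iff_add_eq'] at h
    rw [h]
    refine sub_mem hw ?_
    simpa using mul_mem_homogeneousAt haH hp
  intro j hj i
  have h3 := hb (j + s) (by rwa [coeff_X_pow_mul]) i
  push_cast at h3
  linear_combination h3

/-- One Hensel step: Bézout for the coprime pair `X ^ s`, `p`, with the cofactor of `p` reduced
modulo `X ^ s`. The bound on `w` then bounds the other cofactor. -/
theorem exists_mul_add_X_pow_mul_eq (s : ℕ) {p : K[X]} (hp : p.Monic) (hp0 : p.coeff 0 ≠ 0)
    (w : K[X]) (hw : w.degree < (s + p.natDegree : ℕ)) :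
    ∃ ab : K[X] × K[X], ab.1 * p + X ^ s * ab.2 = w ∧ ab.1.degree < s ∧
      ab.2.degree < p.natDegree := by
  have hcop : IsCoprime (X ^ s) p := by
    refine IsCoprime.pow_left ?_
    rw [Polynomial.irreducible_X.coprime_iff_not_dvd, X_dvd_iff]
    exact hp0
  obtain ⟨u, v, huv⟩ := hcop
  have hXs : (X ^ s : K[X]).Monic := monic_X_pow s
  set a := (w * v) %ₘ X ^ s with ha
  have hdeg : a.degree < s := by
    simpa using degree_modByMonic_lt (w * v) hXs
  have hdvd : X ^ s ∣ w - a * p := by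
    refine ⟨w * u + ((w * v) /ₘ X ^ s) * p, ?_⟩
    have h1 := modByMonic_add_div (w * v) (X ^ s : K[X])
    rw [← ha] at h1
    linear_combination (-w) * huv + (-p) * h1
  obtain ⟨b, hb⟩ := hdvd
  refine ⟨(a, b), by dsimp only; rw [← hb]; ring, hdeg, ?_⟩
  have h2 : (X ^ s * b).degree < ((s + p.natDegree : ℕ) : WithBot ℕ) := by
    rw [← hb]
    refine (degree_sub_le _ _).trans_lt (max_lt hw ?_)
    rw [hp.degree_mul, degree_eq_natDegree hp.ne_zero]
    push_cast
    by_cases ha0 : a = 0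
    · rw [ha0, degree_zero, WithBot.bot_add]; exact_mod_cast WithBot.bot_lt_coe _
    rw [degree_eq_natDegree ha0] at hdeg ⊢
    norm_cast at hdeg ⊢
    lia
  rw [degree_mul, degree_X_pow] at h2
  by_cases hb0 : b = 0
  · rw [hb0, degree_zero]; exact_mod_cast WithBot.bot_lt_coe _
  rw [degree_eq_natDegree hb0] at h2 ⊢
  norm_cast at h2 ⊢
  lia

/-- The coefficient of `x^e` of a polynomial over `K[[x]]`, as a polynomial over `K`. -/
def coeffPoly (h : (MvPowerSeries σ K)[X]) (e : σ →₀ ℕ) : K[X] :=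
  ∑ j ∈ h.support, monomial j (MvPowerSeries.coeff e (h.coeff j))

@[simp]
theorem coeff_coeffPoly (h : (MvPowerSeries σ K)[X]) (e : σ →₀ ℕ) (j : ℕ) :
    (coeffPoly h e).coeff j = MvPowerSeries.coeff e (h.coeff j) := by
  simp only [coeffPoly, finsetSum_coeff, coeff_monomial, Finset.sum_ite_eq', mem_support_iff]
  split_ifs with h0
  · rfl
  · rw [notMem_support_iff.mp h0, map_zero]

theorem coeffPoly_zero (h : (MvPowerSeries σ K)[X]) :
    coeffPoly h 0 = h.map MvPowerSeries.constantCoeff := by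
  ext j
  simp

/-- The power series with given coefficients. -/
def ofCoeff (c : (σ →₀ ℕ) → K) : MvPowerSeries σ K := c

@[simp]
theorem coeff_ofCoeff (c : (σ →₀ ℕ) → K) (e : σ →₀ ℕ) : MvPowerSeries.coeff e (ofCoeff c) = c e :=
  rfl

/-- The polynomial of degree at most `n` over `K[[x]]` with given coefficients of `x^e`. -/
def ofCoeffPoly (n : ℕ) (H : (σ →₀ ℕ) → K[X]) : (MvPowerSeries σ K)[X] :=
  ∑ j ∈ Finset.range (n + 1), monomial j (ofCoeff fun e => (H e).coeff j)

theorem coeff_ofCoeffPoly {n : ℕ} {H : (σ →₀ ℕ) → K[X]} (hH : ∀ e, (H e).natDegree ≤ n)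
    (j : ℕ) (e : σ →₀ ℕ) :
    MvPowerSeries.coeff e ((ofCoeffPoly n H).coeff j) = (H e).coeff j := by
  simp only [ofCoeffPoly]
  rw [finsetSum_coeff]
  simp only [coeff_monomial, Finset.sum_ite_eq', Finset.mem_range]
  split_ifs with h0
  · simp
  · rw [map_zero, coeff_eq_zero_of_natDegree_lt]
    have := hH e
    lia

theorem coeffPoly_ofCoeffPoly {n : ℕ} {H : (σ →₀ ℕ) → K[X]} (hH : ∀ e, (H e).natDegree ≤ n)
    (e : σ →₀ ℕ) : coeffPoly (ofCoeffPoly n H) e = H e := by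
  ext j
  rw [coeff_coeffPoly, coeff_ofCoeffPoly hH]

theorem coeffPoly_injective {g h : (MvPowerSeries σ K)[X]}
    (H : ∀ e, coeffPoly g e = coeffPoly h e) : g = h := by
  ext j e
  rw [← coeff_coeffPoly, H, coeff_coeffPoly]

theorem coeffPoly_mul [DecidableEq σ] (g h : (MvPowerSeries σ K)[X]) (e : σ →₀ ℕ) :
    coeffPoly (g * h) e = ∑ x ∈ Finset.HasAntidiagonal.antidiagonal e, coeffPoly g x.1 * coeffPoly h x.2 := by
  ext j
  simp only [coeff_coeffPoly, coeff_mul, map_sum, finsetSum_coeff, MvPowerSeries.coeff_mul]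
  exact Finset.sum_comm

theorem monic_of_coeffPoly {h : (MvPowerSeries σ K)[X]} {n : ℕ}
    (h0 : (coeffPoly h 0).Monic) (hn : (coeffPoly h 0).natDegree = n)
    (he : ∀ e ≠ 0, (coeffPoly h e).degree < n) : h.Monic ∧ h.natDegree = n := by
  have hle : h.natDegree ≤ n := by
    rw [natDegree_le_iff_coeff_eq_zero]
    intro j hj
    ext e
    rw [← coeff_coeffPoly, map_zero]
    by_cases h : e = 0
    · rw [h]; exact coeff_eq_zero_of_natDegree_lt (hn.trans_lt hj)
    · exact coeff_eq_zero_of_degree_lt ((he e h).trans (by exact_mod_cast hj))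
  have hc : h.coeff n = 1 := by
    classical
    ext e
    rw [← coeff_coeffPoly, MvPowerSeries.coeff_one]
    split_ifs with h
    · rw [h, ← hn]; exact h0
    · exact coeff_eq_zero_of_degree_lt (he e h)
  have hm := monic_of_natDegree_le_of_coeff_eq_one n hle hc
  refine ⟨hm, hle.antisymm (le_natDegree_of_ne_zero ?_)⟩
  rw [hc]; exact one_ne_zero

/-- In a product of two factors, the coefficient of `x^e` involves their coefficients at `e` only
through the two end terms; all other terms use strictly smaller exponents. Here `S` solves for the
new pair and `z` is the pair at `e = 0`. -/
theorem exists_recursion [DecidableEq σ] (S : K[X] → K[X] × K[X]) (z : K[X] × K[X])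
    (w : (σ →₀ ℕ) → K[X]) :
    ∃ H : (σ →₀ ℕ) → K[X] × K[X], H 0 = z ∧ ∀ e ≠ 0,
      H e = S (w e - ∑ x ∈ Finset.HasAntidiagonal.antidiagonal e with x.1 ≠ 0 ∧ x.2 ≠ 0,
        (H x.1).1 * (H x.2).2) := by
  have hlt : ∀ {e : σ →₀ ℕ} {x : (σ →₀ ℕ) × (σ →₀ ℕ)},
      x ∈ (Finset.HasAntidiagonal.antidiagonal e).filter (fun x => x.1 ≠ 0 ∧ x.2 ≠ 0) → x.1 < e ∧ x.2 < e := by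
    intro e x hx
    rw [Finset.mem_filter, Finset.HasAntidiagonal.mem_antidiagonal] at hx
    rw [← hx.1]
    exact ⟨lt_add_of_pos_right _ (pos_iff_ne_zero.mpr hx.2.2),
      lt_add_of_pos_left _ (pos_iff_ne_zero.mpr hx.2.1)⟩
  let F : ∀ e : σ →₀ ℕ, (∀ e' : σ →₀ ℕ, e' < e → K[X] × K[X]) → K[X] × K[X] := fun e IH =>
    if e = 0 then z else
      S (w e - ∑ x ∈ ((Finset.HasAntidiagonal.antidiagonal e).filter (fun x => x.1 ≠ 0 ∧ x.2 ≠ 0)).attach,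
        (IH x.1.1 (hlt x.2).1).1 * (IH x.1.2 (hlt x.2).2).2)
  refine ⟨wellFounded_lt.fix F, ?_, fun e he => ?_⟩
  · rw [WellFounded.fix_eq]; simp [F]
  · rw [WellFounded.fix_eq]
    simp only [F, if_neg he]
    congr 2
    exact Finset.sum_attach _ (fun x : (σ →₀ ℕ) × (σ →₀ ℕ) =>
      (wellFounded_lt.fix F x.1).1 * (wellFounded_lt.fix F x.2).2)

theorem sum_antidiagonal_eq_ends [DecidableEq σ] {M : Type*} [AddCommMonoid M] {e : σ →₀ ℕ}
    (he : e ≠ 0) (G : (σ →₀ ℕ) × (σ →₀ ℕ) → M) :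
    ∑ x ∈ Finset.HasAntidiagonal.antidiagonal e, G x =
      (∑ x ∈ Finset.HasAntidiagonal.antidiagonal e with x.1 ≠ 0 ∧ x.2 ≠ 0, G x) + (G (e, 0) + G (0, e)) := by
  rw [← Finset.sum_filter_add_sum_filter_not (Finset.HasAntidiagonal.antidiagonal e)
    (fun x => x.1 ≠ 0 ∧ x.2 ≠ 0)]
  congr 1
  rw [← Finset.sum_pair (f := G) (by simp [he])]
  refine Finset.sum_congr ?_ fun _ _ => rfl
  ext ⟨x, y⟩
  simp only [Finset.mem_filter, Finset.HasAntidiagonal.mem_antidiagonal, Finset.mem_insert, Finset.mem_singleton,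
    Prod.mk.injEq]
  constructor
  · rintro ⟨rfl, h⟩
    by_cases hx : x = 0
    · simp [hx]
    · have hy : y = 0 := by tauto
      simp [hy]
  · rintro (⟨rfl, rfl⟩ | ⟨rfl, rfl⟩) <;> simp

/-- Hensel's lemma for monic polynomials over `K[[x]]`, with a grading of the monomials by
`(ℤ/k)^σ` under which `T` has degree `-r`. -/
theorem exists_homogeneous_factorization {k : ℕ} {r : σ →₀ ℕ} {s : ℕ} {p : K[X]}
    {h : (MvPowerSeries σ K)[X]} (hm : h.Monic)
    (hh : h.map MvPowerSeries.constantCoeff = X ^ s * p) (hp0 : p.coeff 0 ≠ 0)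
    (hhom : ∀ e, coeffPoly h e ∈ homogeneousAt K k r e h.natDegree) :
    ∃ h₁ h₂ : (MvPowerSeries σ K)[X], h = h₁ * h₂ ∧ h₁.Monic ∧ h₂.Monic ∧
      h₁.map MvPowerSeries.constantCoeff = X ^ s ∧ h₂.map MvPowerSeries.constantCoeff = p ∧
      (∀ e, coeffPoly h₁ e ∈ homogeneousAt K k r e h₁.natDegree) ∧
      (∀ e, coeffPoly h₂ e ∈ homogeneousAt K k r e h₂.natDegree) := by
  classical
  have hXs : (X ^ s : K[X]).Monic := monic_X_pow s
  have hp : p.Monic := hXs.of_mul_monic_left (hh ▸ hm.map _)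
  have hdeg : h.natDegree = s + p.natDegree := by
    rw [← hm.natDegree_map (MvPowerSeries.constantCoeff (σ := σ) (R := K)), hh,
      hXs.natDegree_mul hp, natDegree_X_pow]
  have hdlt : ∀ e ≠ 0, (coeffPoly h e).degree < (s + p.natDegree : ℕ) := by
    intro e he
    rw [degree_lt_iff_coeff_zero]
    intro j hj
    rw [coeff_coeffPoly]
    rcases hj.eq_or_lt with hj | hj
    · rw [← hj, ← hdeg, hm.coeff_natDegree, MvPowerSeries.coeff_one, if_neg he]
    · rw [coeff_eq_zero_of_natDegree_lt (hdeg.trans_lt hj), map_zero]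
  have hpH : p ∈ homogeneousAt K k r 0 p.natDegree := by
    intro j hj i
    have h1 := hhom 0
    rw [coeffPoly_zero, hh] at h1
    have h2 := h1 (j + s) (by rwa [coeff_X_pow_mul]) i
    rw [hdeg] at h2
    push_cast at h2
    linear_combination h2
  -- `S` is only specified on `w` of degree below `s + p.natDegree`. The induction in `main` carries
  -- the degree bounds that keep every right-hand side in this range.
  choose! S hS using exists_mul_add_X_pow_mul_eq s hp hp0
  obtain ⟨H, hH0, hH⟩ := exists_recursion S (X ^ s, p) (coeffPoly h)
  have main : ∀ e ≠ 0, ((H e).1 * p + X ^ s * (H e).2 = coeffPoly h e -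
        ∑ x ∈ Finset.HasAntidiagonal.antidiagonal e with x.1 ≠ 0 ∧ x.2 ≠ 0, (H x.1).1 * (H x.2).2) ∧
      (H e).1.degree < s ∧ (H e).2.degree < p.natDegree ∧
      (H e).1 ∈ homogeneousAt K k r e s ∧ (H e).2 ∈ homogeneousAt K k r e p.natDegree := by
    intro e
    induction e using WellFoundedLT.induction with
    | ind e ih =>
    intro he
    have hlt : ∀ x ∈ (Finset.HasAntidiagonal.antidiagonal e).filter (fun x => x.1 ≠ 0 ∧ x.2 ≠ 0),
        x.1 + x.2 = e ∧ (x.1 < e ∧ x.1 ≠ 0) ∧ (x.2 < e ∧ x.2 ≠ 0) := by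
      intro x hx
      rw [Finset.mem_filter, Finset.HasAntidiagonal.mem_antidiagonal] at hx
      refine ⟨hx.1, ?_⟩
      rw [← hx.1]
      exact ⟨⟨lt_add_of_pos_right _ (pos_iff_ne_zero.mpr hx.2.2), hx.2.1⟩,
        ⟨lt_add_of_pos_left _ (pos_iff_ne_zero.mpr hx.2.1), hx.2.2⟩⟩
    set w := coeffPoly h e -
      ∑ x ∈ Finset.HasAntidiagonal.antidiagonal e with x.1 ≠ 0 ∧ x.2 ≠ 0, (H x.1).1 * (H x.2).2 with hw
    have hwdeg : w.degree < (s + p.natDegree : ℕ) := by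
      refine (degree_sub_le _ _).trans_lt (max_lt (hdlt e he) ?_)
      refine (degree_sum_le _ _).trans_lt ?_
      rw [Finset.sup_lt_iff (by exact_mod_cast WithBot.bot_lt_coe _)]
      intro x hx
      obtain ⟨-, h1, h2⟩ := hlt x hx
      have d1 := (ih _ h1.1 h1.2).2.1
      have d2 := (ih _ h2.1 h2.2).2.2.1
      rw [degree_mul]
      by_cases a0 : (H x.1).1 = 0
      · rw [a0, degree_zero, WithBot.bot_add]; exact_mod_cast WithBot.bot_lt_coe _
      by_cases b0 : (H x.2).2 = 0
      · rw [b0, degree_zero, WithBot.add_bot]; exact_mod_cast WithBot.bot_lt_coe _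
      rw [degree_eq_natDegree a0] at d1 ⊢
      rw [degree_eq_natDegree b0] at d2 ⊢
      norm_cast at d1 d2 ⊢
      lia
    obtain ⟨s1, s2, s3⟩ := hS w hwdeg
    rw [← hH e he] at s1 s2 s3
    have hwH : w ∈ homogeneousAt K k r e (s + p.natDegree) := by
      refine sub_mem (hdeg ▸ hhom e) (sum_mem fun x hx => ?_)
      obtain ⟨h0, h1, h2⟩ := hlt x hx
      rw [← h0]
      exact mul_mem_homogeneousAt (ih _ h1.1 h1.2).2.2.2.1 (ih _ h2.1 h2.2).2.2.2.2
    exact ⟨s1, s2, s3, homogeneous_of_mul_add_X_pow_mul hp0 s1 s2 hpH hwH⟩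
  have hd1 : ∀ e, (H e).1.natDegree ≤ s := by
    intro e
    by_cases he : e = 0
    · simp [he, hH0]
    · exact natDegree_le_iff_degree_le.mpr (main e he).2.1.le
  have hd2 : ∀ e, (H e).2.natDegree ≤ p.natDegree := by
    intro e
    by_cases he : e = 0
    · simp [he, hH0]
    · exact natDegree_le_iff_degree_le.mpr (main e he).2.2.1.le
  have hc1 := coeffPoly_ofCoeffPoly hd1
  have hc2 := coeffPoly_ofCoeffPoly hd2
  have m1 := monic_of_coeffPoly (h := ofCoeffPoly s fun e => (H e).1) (n := s)
    (by rw [hc1, hH0]; exact hXs) (by rw [hc1, hH0]; simp)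
    (fun e he => by rw [hc1]; exact (main e he).2.1)
  have m2 := monic_of_coeffPoly (h := ofCoeffPoly p.natDegree fun e => (H e).2) (n := p.natDegree)
    (by rw [hc2, hH0]; exact hp) (by rw [hc2, hH0])
    (fun e he => by rw [hc2]; exact (main e he).2.2.1)
  refine ⟨ofCoeffPoly s fun e => (H e).1, ofCoeffPoly p.natDegree fun e => (H e).2, ?_,
    m1.1, m2.1, ?_, ?_, ?_, ?_⟩
  · refine coeffPoly_injective fun e => ?_
    rw [coeffPoly_mul]
    simp only [hc1, hc2]
    by_cases he : e = 0
    · rw [he, coeffPoly_zero, hh]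
      simp [hH0]
    · rw [sum_antidiagonal_eq_ends he (fun x => (H x.1).1 * (H x.2).2)]
      simp only [hH0]
      rw [(main e he).1]
      ring
  · rw [← coeffPoly_zero, hc1, hH0]
  · rw [← coeffPoly_zero, hc2, hH0]
  · intro e
    rw [hc1, m1.2]
    by_cases he : e = 0
    · rw [he, hH0]
      intro j hj i
      have : j = s := by
        by_contra hne
        exact hj (by simp [coeff_X_pow, hne])
      simp [this]
    · exact (main e he).2.2.2.1
  · intro e
    rw [hc2, m2.2]
    by_cases he : e = 0
    · rw [he, hH0]; exact hpH
    · exact (main e he).2.2.2.2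

end WeierstrassNewton

/-! ### Descent along `x ↦ x^k`. -/

namespace WeierstrassNewton

variable {σ K : Type*} [Field K]

/-- The ring homomorphism `x ↦ x^k`. -/
abbrev expandHom (σ K : Type*) [Field K] {k : ℕ} (hk : k ≠ 0) :
    MvPowerSeries σ K →+* MvPowerSeries σ K :=
  (MvPowerSeries.expand (σ := σ) (R := K) k hk).toRingHom

theorem mem_range_expand {k : ℕ} (hk : k ≠ 0) {c : MvPowerSeries σ K}
    (hc : ∀ e, MvPowerSeries.coeff e c ≠ 0 → ∀ i, k ∣ e i) :
    ∃ b, MvPowerSeries.expand k hk b = c := by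
  refine ⟨ofCoeff fun e => MvPowerSeries.coeff (k • e) c, ?_⟩
  ext e
  by_cases he : ∀ i, k ∣ e i
  · have : e = k • e.mapRange (fun n => n / k) (Nat.zero_div k) :=
      Finsupp.ext fun i => (Nat.mul_div_cancel' (he i)).symm
    rw [this, MvPowerSeries.coeff_expand_smul, coeff_ofCoeff]
  · have h0 : MvPowerSeries.coeff e c = 0 := by
      by_contra h
      exact he (hc e h)
    obtain ⟨i, hi⟩ := not_forall.mp he
    rw [h0, MvPowerSeries.coeff_expand_of_not_dvd k hk _ hi]

theorem expand_injective {k : ℕ} (hk : k ≠ 0) :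
    Function.Injective (MvPowerSeries.expand (σ := σ) (R := K) k hk) := by
  intro a b h
  ext e
  rw [← MvPowerSeries.coeff_expand_smul k hk, h, MvPowerSeries.coeff_expand_smul]

/-- A term `x^e T^j` of `h` appears on the left with exponent `e + (deg h - j) r`, and a series in
`x^k` only has exponents divisible by `k`. -/
theorem mem_homogeneousAt_of_map_expand_eq {k : ℕ} (hk : k ≠ 0) {r : σ →₀ ℕ}
    {Q h : (MvPowerSeries σ K)[X]}
    (hQ : Q.map (expandHom σ K hk) =
      h.scaleRoots (MvPowerSeries.monomial r 1)) (e : σ →₀ ℕ) :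
    coeffPoly h e ∈ homogeneousAt K k r e h.natDegree := by
  intro j hj i
  rw [coeff_coeffPoly] at hj
  have hjm : j ≤ h.natDegree := by
    by_contra! hlt
    rw [coeff_eq_zero_of_natDegree_lt hlt, map_zero] at hj
    exact hj rfl
  have h1 := congrArg (fun z => MvPowerSeries.coeff (e + (h.natDegree - j) • r) (coeff z j)) hQ
  simp only [coeff_map, coeff_scaleRoots, MvPowerSeries.monomial_pow, one_pow,
    MvPowerSeries.coeff_add_mul_monomial, mul_one] at h1
  have h2 : k ∣ (e + (h.natDegree - j) • r) i := by
    by_contra hnd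
    exact hj (h1.symm.trans (MvPowerSeries.coeff_expand_of_not_dvd k hk _ hnd))
  rw [← ZMod.natCast_eq_zero_iff] at h2
  simpa [Nat.cast_sub hjm] using h2

/-- The converse, which returns the Hensel factors to `K[[x]]`: homogeneity makes every exponent
after scaling divisible by `k`. -/
theorem exists_map_expand_eq_scaleRoots {k : ℕ} (hk : k ≠ 0) {r : σ →₀ ℕ}
    {h : (MvPowerSeries σ K)[X]}
    (hhom : ∀ e, coeffPoly h e ∈ homogeneousAt K k r e h.natDegree) :
    ∃ G : (MvPowerSeries σ K)[X],
      G.map (expandHom σ K hk) =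
        h.scaleRoots (MvPowerSeries.monomial r 1) := by
  classical
  rw [← Polynomial.mem_lifts, Polynomial.lifts_iff_coeff_lifts]
  intro j
  obtain ⟨b, hb⟩ := mem_range_expand (c := (h.scaleRoots (MvPowerSeries.monomial r 1)).coeff j) hk (by
    intro e he i
    rw [coeff_scaleRoots, MvPowerSeries.monomial_pow, one_pow,
      MvPowerSeries.coeff_mul_monomial] at he
    split_ifs at he with hle
    · rw [mul_one, ← coeff_coeffPoly] at he
      have hjm : j ≤ h.natDegree := by
        by_contra! hlt
        rw [coeff_coeffPoly, coeff_eq_zero_of_natDegree_lt hlt, map_zero] at he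
        exact he rfl
      have h1 := hhom _ j he i
      rw [← Nat.cast_sub hjm, ← Nat.cast_mul, ← Nat.cast_add, ZMod.natCast_eq_zero_iff] at h1
      have h2 := hle i
      simp only [Finsupp.smul_apply, Finsupp.tsub_apply, smul_eq_mul] at h1 h2
      rwa [Nat.sub_add_cancel h2] at h1
    · exact absurd rfl he)
  exact ⟨b, hb⟩

/-- Coprimality of monic polynomials means that their resultant is a unit, and units of `K[[x]]` are
detected by the constant term. -/
theorem isCoprime_of_map_constantCoeff {g h : (MvPowerSeries σ K)[X]} (hg : g.Monic) (hh : h.Monic)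
    (H : IsCoprime (g.map MvPowerSeries.constantCoeff) (h.map MvPowerSeries.constantCoeff)) :
    IsCoprime g h := by
  rw [← isUnit_resultant_iff_isCoprime hg, MvPowerSeries.isUnit_iff_constantCoeff,
    ← resultant_map_map]
  have := (isUnit_resultant_iff_isCoprime (hg.map MvPowerSeries.constantCoeff)).mpr H
  rwa [hg.natDegree_map, hh.natDegree_map] at this

/-- A monic polynomial over `K[[x]]` which becomes, after the substitutions `x ↦ x^k` and
`T ↦ x^r T`, a multiple of a polynomial with two coprime factors modulo the maximal ideal, one of
them a power of `T`, factors over `K[[x]]`. -/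
theorem exists_coprime_factorization {k : ℕ} (hk : k ≠ 0) {r : σ →₀ ℕ}
    {Q h : (MvPowerSeries σ K)[X]}
    (hQ : Q.map (expandHom σ K hk) =
      h.scaleRoots (MvPowerSeries.monomial r 1)) (hm : h.Monic)
    (h0 : MvPowerSeries.constantCoeff (h.coeff 0) = 0) {j : ℕ} (hj : j < h.natDegree)
    (hj0 : MvPowerSeries.constantCoeff (h.coeff j) ≠ 0)
    {L : Type*} [Field L] (ι : MvPowerSeries σ K →+* L) (hι : Function.Injective ι) :
    ∃ G₁ G₂ : (MvPowerSeries σ K)[X], Q = G₁ * G₂ ∧ G₁.Monic ∧ G₂.Monic ∧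
      G₁.natDegree ≠ 0 ∧ G₂.natDegree ≠ 0 ∧
      IsCoprime (G₁.map (ι.comp (expandHom σ K hk)))
        (G₂.map (ι.comp (expandHom σ K hk))) := by
  set φ := expandHom σ K hk
  have hφi : Function.Injective φ := expand_injective hk
  set hb : K[X] := h.map MvPowerSeries.constantCoeff with hhb
  have hbm : hb.Monic := hm.map _
  have hbd : hb.natDegree = h.natDegree := hm.natDegree_map _
  obtain ⟨p, hp, hpX⟩ := exists_eq_pow_rootMultiplicity_mul_and_not_dvd hb hbm.ne_zero 0
  rw [map_zero, sub_zero] at hp hpX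
  set s := rootMultiplicity 0 hb
  rw [X_dvd_iff] at hpX
  have hs0 : s ≠ 0 := by
    intro hs
    rw [hs, pow_zero, one_mul] at hp
    apply hpX
    rw [← hp, hhb, coeff_map, h0]
  have hsm : s ≤ j := by
    by_contra! hlt
    apply hj0
    rw [← coeff_map, ← hhb, hp, coeff_X_pow_mul', if_neg (not_le.mpr hlt)]
  have hpm : p.Monic := (monic_X_pow s).of_mul_monic_left (hp ▸ hbm)
  have hpd : p.natDegree ≠ 0 := by
    have : hb.natDegree = s + p.natDegree := by
      conv_lhs => rw [hp]
      rw [(monic_X_pow s).natDegree_mul hpm, natDegree_X_pow]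
    lia
  obtain ⟨h₁, h₂, hmul, m₁, m₂, c₁, c₂, H₁, H₂⟩ := exists_homogeneous_factorization hm hp hpX
    (mem_homogeneousAt_of_map_expand_eq hk hQ)
  obtain ⟨G₁, hG₁⟩ := exists_map_expand_eq_scaleRoots hk H₁
  obtain ⟨G₂, hG₂⟩ := exists_map_expand_eq_scaleRoots hk H₂
  have hcop : IsCoprime h₁ h₂ := by
    apply isCoprime_of_map_constantCoeff m₁ m₂
    rw [c₁, c₂]
    refine IsCoprime.pow_left ?_
    rw [Polynomial.irreducible_X.coprime_iff_not_dvd, X_dvd_iff]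
    exact hpX
  have d₁ : G₁.natDegree = s := by
    rw [← natDegree_map_eq_of_injective hφi, hG₁, natDegree_scaleRoots,
      ← m₁.natDegree_map (MvPowerSeries.constantCoeff (σ := σ) (R := K)), c₁, natDegree_X_pow]
  have d₂ : G₂.natDegree = p.natDegree := by
    rw [← natDegree_map_eq_of_injective hφi, hG₂, natDegree_scaleRoots,
      ← m₂.natDegree_map (MvPowerSeries.constantCoeff (σ := σ) (R := K)), c₂]
  -- Scaling roots by `x^r` preserves coprimality where `x^r` is a unit, hence the passage to the
  -- field `L`.
  have hunit : IsUnit (ι (MvPowerSeries.monomial r 1)) := by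
    rw [isUnit_iff_ne_zero, map_ne_zero_iff ι hι]
    intro h
    have := congrArg (MvPowerSeries.coeff r) h
    rw [MvPowerSeries.coeff_monomial_same, map_zero] at this
    exact one_ne_zero this
  refine ⟨G₁, G₂, ?_, ?_, ?_, by rwa [d₁], by rwa [d₂], ?_⟩
  · apply map_injective φ hφi
    rw [Polynomial.map_mul, hG₁, hG₂, hQ, hmul, mul_scaleRoots']
    rw [m₁, m₂]; simp
  · rw [hφi.monic_map_iff, hG₁, monic_scaleRoots_iff]; exact m₁
  · rw [hφi.monic_map_iff, hG₂, monic_scaleRoots_iff]; exact m₂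
  · rw [← Polynomial.map_map, ← Polynomial.map_map, hG₁, hG₂, map_scaleRoots _ _ _ (by simp [m₁]),
      map_scaleRoots _ _ _ (by simp [m₂])]
    exact isCoprime_scaleRoots _ _ _ hunit (hcop.map (mapRingHom ι))

end WeierstrassNewton

/-! ### The resultant and the irreducibility of `g`. -/

namespace WeierstrassNewton

section resultant

variable {A : Type*} [CommRing A]

theorem map_resultantSubT [IsDomain A] {E : Type*} [Field E] [IsAlgClosed E] (ι : A →+* E)
    {g : A[X]} (hg : g.Monic) (f : A[X]) :
    (resultantSubT g f).map ι =
      ((g.map ι).roots.map fun β => C ((f.map ι).eval β) - X).prod := by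
  have hC : ∀ u : A[X], (u.map C).map (mapRingHom ι) = (u.map ι).map C := fun u => by
    rw [Polynomial.map_map, Polynomial.map_map]
    congr 1
    ext a
    simp
  have h1 : (f.map C - C X : A[X][X]).map (mapRingHom ι) = (f.map ι).map C - C X := by
    rw [Polynomial.map_sub, hC, map_C]
    simp
  have hsplit : (g.map ι).Splits := IsAlgClosed.splits _
  have hgm : (g.map ι).Monic := hg.map ι
  -- The degree is the one before `ι` is applied, since it may drop. As `g` is monic, the
  -- leading-coefficient factor is `1` regardless.
  have h2 := resultant_eq_prod_eval ((g.map ι).map C) ((f.map ι).map C - C X)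
    (f.map C - C X : A[X][X]).natDegree (by rw [← h1]; exact natDegree_map_le) (hsplit.map C)
  rw [(hgm.map C).leadingCoeff, one_pow, one_mul, (hgm.natDegree_map C), hg.natDegree_map,
    hsplit.roots_map_of_injective C_injective, Multiset.map_map] at h2
  rw [resultantSubT, ← coe_mapRingHom, ← resultant_map_map, hC, h1, (hg.natDegree_map C), h2]
  congr 2
  ext β
  simp [eval_map]

theorem natDegree_and_leadingCoeff_resultantSubT [IsDomain A] {g : A[X]} (hg : g.Monic)
    (f : A[X]) : (resultantSubT g f).natDegree = g.natDegree ∧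
      (resultantSubT g f).leadingCoeff = (-1) ^ g.natDegree := by
  set E := AlgebraicClosure (FractionRing A)
  set ι : A →+* E := (algebraMap (FractionRing A) E).comp (algebraMap A (FractionRing A))
  have hι : Function.Injective ι :=
    (algebraMap (FractionRing A) E).injective.comp (IsFractionRing.injective A _)
  have hcard : (g.map ι).roots.card = g.natDegree := by
    rw [← hg.natDegree_map ι]
    exact (IsAlgClosed.splits (g.map ι)).natDegree_eq_card_roots.symm
  have hmap : (resultantSubT g f).map ι = C ((-1) ^ g.natDegree) *
      ((g.map ι).roots.map fun β => X - C ((f.map ι).eval β)).prod := by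
    rw [map_resultantSubT ι hg, ← hcard]
    induction (g.map ι).roots using Multiset.induction with
    | empty => simp
    | cons β t ih =>
      simp only [Multiset.map_cons, Multiset.prod_cons, Multiset.card_cons, ih, pow_succ, map_mul,
        map_pow, map_neg, map_one]
      ring
  have hprod : (((g.map ι).roots.map fun β => X - C ((f.map ι).eval β)).prod).Monic :=
    monic_multiset_prod_of_monic _ _ fun β _ => monic_X_sub_C _
  have hu : ((-1 : E) ^ g.natDegree) ≠ 0 := pow_ne_zero _ (neg_ne_zero.mpr one_ne_zero)
  constructor
  · rw [← natDegree_map_eq_of_injective hι, hmap, natDegree_C_mul hu,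
      natDegree_multiset_prod_of_monic _ (by
        intro z hz
        obtain ⟨β, -, rfl⟩ := Multiset.mem_map.mp hz
        exact monic_X_sub_C _)]
    simp [hcard]
  · apply hι
    rw [← leadingCoeff_map_of_injective hι, hmap, leadingCoeff_mul, hprod.leadingCoeff,
      leadingCoeff_C]
    simp

/-- A root of `G` is a root of the resultant, hence equals `f(β)` for a root `β` of `g`. By Gauss's
lemma over the normal ring `A`, `g` is the minimal polynomial of `β`, which is a root of `G ∘ f`. -/
theorem dvd_comp_of_dvd_resultantSubT [IsDomain A] [IsIntegrallyClosed A] {g : A[X]}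
    (hg : g.Monic) (hirr : Irreducible g) {f G : A[X]} (hG : G.Monic) (hG0 : G.natDegree ≠ 0)
    (hdvd : G ∣ resultantSubT g f) : g ∣ G.comp f := by
  set F := FractionRing A
  set E := AlgebraicClosure F
  set ι : A →+* E := (algebraMap F E).comp (algebraMap A F)
  obtain ⟨t, ht⟩ := IsAlgClosed.exists_root (G.map ι) (by
    rw [degree_eq_natDegree (hG.map ι).ne_zero, hG.natDegree_map]; exact_mod_cast hG0)
  have h1 : ((resultantSubT g f).map ι).eval t = 0 := by
    obtain ⟨q, hq⟩ := hdvd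
    rw [hq, Polynomial.map_mul, eval_mul, ht.eq_zero, zero_mul]
  rw [map_resultantSubT ι hg, eval_multiset_prod, Multiset.prod_eq_zero_iff] at h1
  simp only [Multiset.map_map, Multiset.mem_map, Function.comp_apply, eval_sub, eval_C, eval_X,
    sub_eq_zero] at h1
  obtain ⟨β, hβ, rfl⟩ := h1
  have hgF : Irreducible (g.map (algebraMap A F)) :=
    (hg.irreducible_iff_irreducible_map_fraction_map).mp hirr
  have hroot : aeval β (g.map (algebraMap A F)) = 0 := by
    rw [aeval_def, ← eval_map, Polynomial.map_map]
    exact (mem_roots'.mp hβ).2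
  have hmin := minpoly.eq_of_irreducible_of_monic hgF hroot (hg.map _)
  rw [← map_dvd_map (algebraMap A F) (IsFractionRing.injective A F) hg, hmin]
  apply minpoly.dvd
  rw [aeval_def, ← eval_map, Polynomial.map_map, Polynomial.map_comp, eval_comp]
  exact ht

theorem not_irreducible_of_resultantSubT_factorization [IsDomain A] [IsIntegrallyClosed A]
    {g f G₁ G₂ : A[X]} (hg : g.Monic) (h₁ : G₁.Monic) (h₂ : G₂.Monic) (d₁ : G₁.natDegree ≠ 0)
    (d₂ : G₂.natDegree ≠ 0) (hdvd : G₁ * G₂ ∣ resultantSubT g f) {L : Type*} [Field L]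
    (ψ : A →+* L) (hcop : IsCoprime (G₁.map ψ) (G₂.map ψ)) : ¬ Irreducible g := by
  intro hirr
  have e₁ := map_dvd (mapRingHom ψ)
    (dvd_comp_of_dvd_resultantSubT hg hirr h₁ d₁ ((dvd_mul_right _ _).trans hdvd))
  have e₂ := map_dvd (mapRingHom ψ)
    (dvd_comp_of_dvd_resultantSubT hg hirr h₂ d₂ ((dvd_mul_left _ _).trans hdvd))
  simp only [coe_mapRingHom, Polynomial.map_comp] at e₁ e₂
  -- Substituting `f` for the variable is a ring homomorphism, so it carries the Bézout identity
  -- along.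
  have hc := hcop.map (compRingHom (f.map ψ))
  have hu : IsUnit (g.map ψ) := hc.isUnit_of_dvd' e₁ e₂
  have h0 : g.natDegree = 0 := by
    rw [← hg.natDegree_map ψ]
    exact natDegree_eq_zero_of_isUnit hu
  exact hirr.not_isUnit (by rw [eq_one_of_monic_natDegree_zero hg h0]; exact isUnit_one)

end resultant

end WeierstrassNewton

/-! ### Fractional power series and the slope condition. -/

namespace WeierstrassNewton

variable {d : ℕ} {K : Type*} [Field K] {k : ℕ}

/-- The inclusion of exponents `ℕ^d ≅ ((1/k) ℕ)^d ⊆ ℚ^d`. -/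
def rootExponentHom (d k : ℕ) : (Fin d →₀ ℕ) →+ (Fin d → ℚ) where
  toFun n j := (n j : ℚ) / k
  map_zero' := by ext; simp
  map_add' _ _ := by ext; simp [add_div]

theorem rootExponentHom_apply (n : Fin d →₀ ℕ) (j : Fin d) :
    rootExponentHom d k n j = (n j : ℚ) / k := rfl

theorem rootExponentHom_le_iff (hk : k ≠ 0) (a b : Fin d →₀ ℕ) :
    rootExponentHom d k a ≤ rootExponentHom d k b ↔ a ≤ b := by
  have : (0 : ℚ) < k := by positivity
  simp [rootExponentHom_apply, Pi.le_def, Finsupp.le_def, div_le_div_iff_of_pos_right this]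

theorem rootExponentHom_injective (hk : k ≠ 0) : Function.Injective (rootExponentHom d k) := by
  intro a b h
  exact le_antisymm ((rootExponentHom_le_iff hk a b).mp h.le)
    ((rootExponentHom_le_iff hk b a).mp h.ge)

theorem rootExponentHom_smul (hk : k ≠ 0) (n : Fin d →₀ ℕ) :
    rootExponentHom d k (k • n) = exponentHom d n := by
  ext j
  have : (k : ℚ) ≠ 0 := by positivity
  simp [rootExponentHom_apply, exponentHom, this]

/-- The embedding of `K[[x]]` into Hahn series with image `K[[x^{1/k}]]`, `x_j ↦ x_j^{1/k}`. -/
def rootEmbedding (d : ℕ) (K : Type*) [Field K] (hk : k ≠ 0) :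
    MvPowerSeries (Fin d) K →+* HahnSeries (Fin d → ℚ) K :=
  (HahnSeries.embDomainRingHom (rootExponentHom d k) (rootExponentHom_injective hk)
    (rootExponentHom_le_iff hk)).comp (RingEquiv.toRingHom HahnSeries.toMvPowerSeries.symm)

theorem coeff_rootEmbedding (hk : k ≠ 0) (c : MvPowerSeries (Fin d) K) (n : Fin d →₀ ℕ) :
    (rootEmbedding d K hk c).coeff (rootExponentHom d k n) = MvPowerSeries.coeff n c :=
  HahnSeries.embDomain_coeff (f := ⟨⟨rootExponentHom d k, rootExponentHom_injective hk⟩,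
    rootExponentHom_le_iff hk _ _⟩) (x := HahnSeries.toMvPowerSeries.symm c)

theorem coeff_rootEmbedding_of_notMem_range (hk : k ≠ 0) (c : MvPowerSeries (Fin d) K)
    {e : Fin d → ℚ} (he : e ∉ Set.range (rootExponentHom d k)) :
    (rootEmbedding d K hk c).coeff e = 0 :=
  HahnSeries.embDomain_of_notMem_range (f := ⟨⟨rootExponentHom d k, rootExponentHom_injective hk⟩,
    rootExponentHom_le_iff hk _ _⟩) (x := HahnSeries.toMvPowerSeries.symm c) he

theorem coeff_ofPowerSeries (c : MvPowerSeries (Fin d) K) (n : Fin d →₀ ℕ) :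
    (ofPowerSeries d K c).coeff (exponentHom d n) = MvPowerSeries.coeff n c :=
  HahnSeries.embDomain_coeff (f := ⟨⟨exponentHom d, exponentHom_injective d⟩,
    exponentHom_le_iff d _ _⟩) (x := HahnSeries.toMvPowerSeries.symm c)

theorem coeff_ofPowerSeries_of_notMem_range (c : MvPowerSeries (Fin d) K)
    {e : Fin d → ℚ} (he : e ∉ Set.range (exponentHom d)) :
    (ofPowerSeries d K c).coeff e = 0 :=
  HahnSeries.embDomain_of_notMem_range (f := ⟨⟨exponentHom d, exponentHom_injective d⟩,
    exponentHom_le_iff d _ _⟩) (x := HahnSeries.toMvPowerSeries.symm c) he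

theorem rootEmbedding_injective (hk : k ≠ 0) :
    Function.Injective (rootEmbedding d K hk) := by
  intro a b h
  ext n
  rw [← coeff_rootEmbedding hk, h, coeff_rootEmbedding]

theorem rootEmbedding_expandHom (hk : k ≠ 0) (c : MvPowerSeries (Fin d) K) :
    rootEmbedding d K hk (expandHom (Fin d) K hk c) = ofPowerSeries d K c := by
  ext e
  by_cases he : e ∈ Set.range (exponentHom d)
  · obtain ⟨n, rfl⟩ := he
    rw [coeff_ofPowerSeries, ← rootExponentHom_smul hk, coeff_rootEmbedding]
    exact MvPowerSeries.coeff_expand_smul k hk c n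
  · rw [coeff_ofPowerSeries_of_notMem_range c he]
    by_cases he' : e ∈ Set.range (rootExponentHom d k)
    · obtain ⟨n, rfl⟩ := he'
      rw [coeff_rootEmbedding]
      by_cases hn : ∀ i, k ∣ n i
      · refine absurd ⟨n.mapRange (fun n => n / k) (Nat.zero_div k), ?_⟩ he
        rw [← rootExponentHom_smul hk]
        congr 1
        exact Finsupp.ext fun i => Nat.mul_div_cancel' (hn i)
      · obtain ⟨i, hi⟩ := not_forall.mp hn
        exact MvPowerSeries.coeff_expand_of_not_dvd k hk c hi
    · exact coeff_rootEmbedding_of_notMem_range hk _ he'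

theorem rootEmbedding_monomial (hk : k ≠ 0) (r : Fin d →₀ ℕ) :
    rootEmbedding d K hk (MvPowerSeries.monomial r 1) = fracMonomial K (rootExponentHom d k r) := by
  classical
  ext e
  rw [fracMonomial, HahnSeries.coeff_single]
  by_cases he : e ∈ Set.range (rootExponentHom d k)
  · obtain ⟨n, rfl⟩ := he
    rw [coeff_rootEmbedding, MvPowerSeries.coeff_monomial]
    simp only [(rootExponentHom_injective hk).eq_iff]
  · rw [coeff_rootEmbedding_of_notMem_range hk _ he, if_neg]
    rintro rfl
    exact he ⟨r, rfl⟩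

theorem rootEmbedding_mem (hk : k ≠ 0) (c : MvPowerSeries (Fin d) K) :
    rootEmbedding d K hk c ∈ fracPowerSeries d K := by
  refine ⟨k, Nat.pos_of_ne_zero hk, fun e he j => ?_⟩
  by_cases he' : e ∈ Set.range (rootExponentHom d k)
  · obtain ⟨n, rfl⟩ := he'
    exact ⟨n j, rfl⟩
  · exact absurd (coeff_rootEmbedding_of_notMem_range hk c he') he

theorem exists_eq_natCast_div_of_dvd {l : ℕ} (hl : l ≠ 0) (hkl : k ∣ l) {x : ℚ}
    (hx : ∃ n : ℕ, x = (n : ℚ) / k) : ∃ n : ℕ, x = (n : ℚ) / l := by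
  obtain ⟨n, rfl⟩ := hx
  obtain ⟨t, rfl⟩ := hkl
  have hk : (k : ℚ) ≠ 0 := by exact_mod_cast left_ne_zero_of_mul hl
  have ht : (t : ℚ) ≠ 0 := by exact_mod_cast right_ne_zero_of_mul hl
  exact ⟨n * t, by push_cast; field_simp⟩

theorem exists_rootExponentHom_eq {q : Fin d → ℚ} (hq : ∀ j, ∃ n : ℕ, q j = (n : ℚ) / k) :
    ∃ r, rootExponentHom d k r = q := by
  choose n hn using hq
  exact ⟨Finsupp.equivFunOnFinite.symm n, funext fun j => (hn j).symm⟩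

theorem exists_rootEmbedding_eq (hk : k ≠ 0) {w : HahnSeries (Fin d → ℚ) K}
    (hw : ∀ e ∈ w.support, ∀ j, ∃ n : ℕ, e j = (n : ℚ) / k) :
    ∃ c, rootEmbedding d K hk c = w := by
  refine ⟨ofCoeff fun n => w.coeff (rootExponentHom d k n), ?_⟩
  ext e
  by_cases he : e ∈ Set.range (rootExponentHom d k)
  · obtain ⟨n, rfl⟩ := he
    rw [coeff_rootEmbedding, coeff_ofCoeff]
  · rw [coeff_rootEmbedding_of_notMem_range hk _ he]
    by_contra h
    exact he (exists_rootExponentHom_eq (hw e (Ne.symm h)))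

theorem fracMonomial_pow (q : Fin d → ℚ) (i : ℕ) :
    fracMonomial K q ^ i = fracMonomial K (i • q) := by
  simp [fracMonomial]

theorem isUnit_fracMonomial (q : Fin d → ℚ) : IsUnit (fracMonomial K q) := by
  refine IsUnit.of_mul_eq_one (fracMonomial K (-q)) ?_
  simp [fracMonomial]

theorem self_mem_fracMultiples (α : HahnSeries (Fin d → ℚ) K) : α ∈ fracMultiples α :=
  ⟨1, one_mem _, (mul_one α).symm⟩

/-- The quotients of the coefficients by `x^(iq)` are fractional power series `w i`. Equality at
`i₀` makes `w i₀` a unit, strictness at `m` prevents `w m` from being one, and a common denominator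
`k` moves everything into `K[[x]]`. -/
theorem exists_slope_data {P : (MvPowerSeries (Fin d) K)[X]} (hP : HasSlopeCondition P) :
    ∃ (k : ℕ) (hk : k ≠ 0) (r : Fin d →₀ ℕ) (c : ℕ → MvPowerSeries (Fin d) K),
      (∀ i ≤ P.natDegree, expandHom (Fin d) K hk (P.coeff (P.natDegree - i)) =
        MvPowerSeries.monomial r 1 ^ i * c i) ∧
      (∃ i, 1 ≤ i ∧ i < P.natDegree ∧ IsUnit (c i)) ∧ ¬ IsUnit (c P.natDegree) := by
  obtain ⟨q, h1, ⟨i₀, hi0, him, h2⟩, h3⟩ := hP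
  set m := P.natDegree
  have hw : ∀ i ≤ m, ∃ w ∈ fracPowerSeries d K,
      ofPowerSeries d K (P.coeff (m - i)) = fracMonomial K q ^ i * w := by
    intro i hi
    rcases Nat.eq_zero_or_pos i with rfl | hpos
    · exact ⟨_, ofPowerSeries_mem _, by rw [pow_zero, one_mul]⟩
    · rw [fracMonomial_pow]
      exact h1 i hpos hi (self_mem_fracMultiples _)
  choose! w hwmem hw using hw
  obtain ⟨v, hvmem, hv⟩ : fracMonomial K (i₀ • q) ∈
      fracMultiples (ofPowerSeries d K (P.coeff (m - i₀))) := h2 ▸ self_mem_fracMultiples _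
  have hwv : w i₀ * v = 1 := by
    rw [hw i₀ him.le, fracMonomial_pow, mul_assoc] at hv
    exact (isUnit_fracMonomial (K := K) (i₀ • q)).mul_left_cancel (by rw [← hv, mul_one])
  -- Equality at `i₀` puts the monomial `x^(i₀ q)` itself in the ring, so the entries of `q` are
  -- nonnegative and `r` can have natural entries.
  obtain ⟨k₀, hk₀, hq0⟩ : fracMonomial K (i₀ • q) ∈ fracPowerSeries d K := by
    rw [hv]
    exact mul_mem (ofPowerSeries_mem _) hvmem
  have hq : ∀ j, ∃ n : ℕ, q j = (n : ℚ) / (i₀ * k₀ : ℕ) := by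
    intro j
    obtain ⟨n, hn⟩ := hq0 (i₀ • q) (by simp [fracMonomial]) j
    refine ⟨n, ?_⟩
    have : (i₀ : ℚ) ≠ 0 := by positivity
    have : (k₀ : ℚ) ≠ 0 := by positivity
    simp only [Pi.smul_apply, nsmul_eq_mul] at hn
    push_cast
    field_simp at hn ⊢
    linarith
  obtain ⟨kv, hkv, hv'⟩ := hvmem
  have hwmem' : ∀ i ≤ m, ∃ k : ℕ, 0 < k ∧ ∀ e ∈ (w i).support, ∀ j, ∃ n : ℕ, e j = (n : ℚ) / k :=
    hwmem
  choose! kw hkw hw' using hwmem'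
  -- A common denominator for `q`, for the inverse `v` of `w i₀`, and for all the `w i`.
  set k := (i₀ * k₀) * kv * ∏ i ∈ Finset.range (m + 1), kw i with hkdef
  have hk : k ≠ 0 := by
    refine mul_ne_zero (mul_ne_zero (by positivity) hkv.ne') (Finset.prod_ne_zero_iff.mpr ?_)
    intro i hi
    exact (hkw i (by simpa [Nat.lt_succ_iff] using hi)).ne'
  obtain ⟨r, hr⟩ := exists_rootExponentHom_eq (k := k)
    fun j => exists_eq_natCast_div_of_dvd hk ⟨kv * ∏ i ∈ Finset.range (m + 1), kw i,
      by rw [hkdef, mul_assoc]⟩ (hq j)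
  obtain ⟨v', hv'⟩ := exists_rootEmbedding_eq hk fun e he j =>
    exists_eq_natCast_div_of_dvd hk ⟨i₀ * k₀ * ∏ i ∈ Finset.range (m + 1), kw i,
      by rw [hkdef]; ring⟩ (hv' e he j)
  have hc : ∀ i ≤ m, ∃ c, rootEmbedding d K hk c = w i := fun i hi =>
    exists_rootEmbedding_eq hk fun e he j => exists_eq_natCast_div_of_dvd hk
      ((Finset.dvd_prod_of_mem kw (by simpa [Nat.lt_succ_iff] using hi)).mul_left _) (hw' i hi e he j)
  choose! c hc using hc
  refine ⟨k, hk, r, c, fun i hi => ?_, ⟨i₀, hi0, him, ?_⟩, fun hu => ?_⟩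
  · apply rootEmbedding_injective hk
    rw [rootEmbedding_expandHom, map_mul, map_pow, rootEmbedding_monomial, hr, hc i hi, hw i hi]
  · refine IsUnit.of_mul_eq_one v' (rootEmbedding_injective hk ?_)
    rw [map_mul, hc i₀ him.le, hv', hwv, map_one]
  · obtain ⟨b, hb⟩ := hu.exists_right_inv
    refine h3.2 ?_
    rintro y ⟨z, hz, rfl⟩
    refine ⟨rootEmbedding d K hk b * z, mul_mem (rootEmbedding_mem hk b) hz, ?_⟩
    have h5 := hw m le_rfl
    rw [Nat.sub_self] at h5
    have h6 : w m * rootEmbedding d K hk b = 1 := by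
      rw [← hc m le_rfl, ← map_mul, hb, map_one]
    rw [h5, fracMonomial_pow, mul_assoc, ← mul_assoc (w m), h6, one_mul]

end WeierstrassNewton

end

/-! ### Assembly of the proof. -/

theorem mainTheorem10 {d : ℕ} {K : Type*} [Field K] [CharZero K]
    (f g : Polynomial (MvPowerSeries (Fin d) K))
    (hf : WeierstrassNewton.IsWeierstrass f) (hg : WeierstrassNewton.IsWeierstrass g)
    (hR : WeierstrassNewton.HasSlopeCondition (WeierstrassNewton.resultantSubT g f)) :
    ¬ Irreducible g := by
  have : IsDomain (MvPowerSeries (Fin d) K) := NoZeroDivisors.to_isDomain _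
  obtain ⟨hdeg, hlc⟩ := WeierstrassNewton.natDegree_and_leadingCoeff_resultantSubT hg.1 f
  obtain ⟨k, hk, r, c, hc, ⟨i, hi1, him, hi⟩, hm⟩ := WeierstrassNewton.exists_slope_data hR
  set P := WeierstrassNewton.resultantSubT g f
  set m := P.natDegree with hmdef
  set ε : MvPowerSeries (Fin d) K := (-1) ^ g.natDegree with hε
  have hεε : ε * ε = 1 := by rw [hε, ← mul_pow]; simp
  have hφε : WeierstrassNewton.expandHom (Fin d) K hk ε = ε := by simp [hε]
  have hc0 : c 0 = ε := by
    have := hc 0 (Nat.zero_le _)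
    rw [pow_zero, one_mul, Nat.sub_zero, hmdef, coeff_natDegree, hlc] at this
    rw [← this, hφε]
  -- `scaleRoots` multiplies the coefficient of `T^j` by `x^((m-j) r)`, hence the index `m - j`. The
  -- sign `ε`, equal to `c 0`, makes `h` monic.
  set h : (MvPowerSeries (Fin d) K)[X] :=
    ∑ j ∈ Finset.range (m + 1), monomial j (ε * c (m - j)) with hh
  have hcoeff : ∀ j, h.coeff j = if j < m + 1 then ε * c (m - j) else 0 := by
    intro j
    simp [hh, finsetSum_coeff, coeff_monomial]
  have hle : h.natDegree ≤ m := by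
    rw [natDegree_le_iff_coeff_eq_zero]
    intro j hj
    rw [hcoeff, if_neg (by lia)]
  have htop : h.coeff m = 1 := by
    rw [hcoeff, if_pos (by lia), Nat.sub_self, hc0, hεε]
  have hmonic : h.Monic := monic_of_natDegree_le_of_coeff_eq_one m hle htop
  have hhdeg : h.natDegree = m :=
    hle.antisymm (le_natDegree_of_ne_zero (by rw [htop]; exact one_ne_zero))
  have hQ : (C ε * P).map (WeierstrassNewton.expandHom (Fin d) K hk) =
      h.scaleRoots (MvPowerSeries.monomial r 1) := by
    ext1 j
    rw [coeff_map, coeff_C_mul, map_mul, hφε, coeff_scaleRoots, hhdeg, hcoeff]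
    split_ifs with hj
    · have := hc (m - j) (by lia)
      rw [Nat.sub_sub_self (by lia)] at this
      rw [this]
      ring
    · rw [coeff_eq_zero_of_natDegree_lt (by lia : P.natDegree < j)]
      simp
  have hεu : IsUnit ε := IsUnit.of_mul_eq_one ε hεε
  obtain ⟨G₁, G₂, hG, m₁, m₂, d₁, d₂, hcop⟩ := WeierstrassNewton.exists_coprime_factorization hk hQ hmonic
    (by
      rw [hcoeff, if_pos (by lia), Nat.sub_zero]
      by_contra h0
      rw [map_mul] at h0
      exact hm (MvPowerSeries.isUnit_iff_constantCoeff.mpr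
        (isUnit_iff_ne_zero.mpr (right_ne_zero_of_mul h0))))
    (j := m - i) (by lia)
    (by
      rw [hcoeff, if_pos (by lia), Nat.sub_sub_self him.le]
      exact ((hεu.mul hi).map MvPowerSeries.constantCoeff).ne_zero)
    (algebraMap (MvPowerSeries (Fin d) K) (FractionRing (MvPowerSeries (Fin d) K)))
    (IsFractionRing.injective _ _)
  refine WeierstrassNewton.not_irreducible_of_resultantSubT_factorization (f := f) hg.1 m₁ m₂ d₁ d₂ ?_ _ hcop
  refine ⟨C ε, ?_⟩
  rw [← hG, mul_right_comm, ← C_mul, hεε, C_1, one_mul]
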